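/- **Setting and notation.** Let $G$ be a finite abelian group and $\widehat G$ its dual group, the homomorphisms from $G$ to the circle group. For nonempty $E\subseteq G$ and $B\subseteq\widehat G$ with $|E|=|B|=n$, let $L^2(E)$ be the space of functions $f:E\to\mathbb C$ with $\|f\|^2=\sum_{x\in E}|f(x)|^2$. Let $L_E(B)$ be the largest $A$ and $U_E(B)$ the smallest $A'$ such that $$A\sum_{b\in B}|c_b|^2\le\Big\|\sum_{b\in B}c_b\,b\Big\|_{L^2(E)}^2\le A'\sum_{b\in B}|c_b|^2\qquad\text{for all }(c_b)\in\mathbb C^B,$$ and let $D_E(B)=|\det[b(x)]_{x\in E,\,b\in B}|$. Put $\rho_E(B)=U_E(B)/L_E(B)$, $\widetilde L_E(B)=n/L_E(B)$, $\widetilde U_E(B)=U_E(B)/n$ and $\widetilde D_E(B)=\sqrt n/D_E(B)^{1/n}$, with the value $\infty$ when the denominator is $0$. For each $Q\in\{\rho,\widetilde L,\widetilde U,\widetilde D\}$ let $Q(E)=\min_B Q_E(B)$, the minimum over all $B\subseteq\widehat G$ with $|B|=|E|$. Call $(E,B)$ a *basis pair* if the restrictions to $E$ of the elements of $B$ form a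 basis of $L^2(E)$. Let $H$ be a subgroup of $G$. A set $E\subseteq G$ *multi-tiles $G$ by $H$ at level $\ell$*, where $\ell\ge 1$ is an integer, if every point of $G$ lies in exactly $\ell$ of the translates $E+h$, $h\in H$. The *translated $H$-cross sections* of $E$ are the sets $(E\cap(g+H))-g\subseteq H$, $g\in G$; up to translation by an element of $H$ such a set depends only on the coset $g+H$. They *have a simultaneous basis in $\widehat H$* if, for some choice of a representative of each coset of $H$, there is one set $B\subseteq\widehat H$ that forms a basis pair (in the group $H$) with the translated $H$-cross section of every chosen representative. **Theorem 1.6.** Let $E$ be a subset of a finite abelian group $G$ that multi-tiles $G$ by a subgroup $H$ at level $\ell\ge 1$. Suppose that $E$ has exactly $k$ distinct translated $H$-cross sections up to $H$-translation, and that these have a simultaneous basis in $\widehat H$. Then $$\rho(E)<e\,\ell^{k\ell+1}.$$ If moreover $\ell>1$, then $$\widetilde L(E)<e\,\ell^{k\ell},\qquad \widetilde U(E)<\ell-\frac{\ell-1}{2^{k+1}\ell^{k}},\qquad \widetilde D(E)\le\sqrt{\ell}.$$ Consequently, let $(G_n)$ be a sequence of finite abelian groups with subgroups $H_n$ and subsets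 $E_n\subseteq G_n$ such that $E_n$ multi-tiles $G_n$ by $H_n$ at level $\ell_n\ge1$, has $k_n$ distinct translated $H_n$-cross sections up to $H_n$-translation, and these have a simultaneous basis in $\widehat{H_n}$. If $(\ell_n)$ and $(k_n)$ are bounded, then $(\rho(E_n))$ is bounded; in particular $\rho(E_n)\not\to\infty$. -/

import Mathlib

open scoped ENNReal Topology

namespace RieszTightness

noncomputable section

variable {G : Type*} [AddCommGroup G]

/-! ### Pairs: subsets of a finite abelian group against sets of characters

The dual group of `G` is `AddChar G Circle`, the homomorphisms from `G` to the circle group.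
`L²(E)` is the space of functions `E → ℂ` with `‖f‖² = ∑ x ∈ E, |f x|²`. -/

/-- The Fourier matrix `T(E, B)`: the entry at `(x, b)` is `b x`. -/
def fourierMatrix (E : Finset G) (B : Finset (AddChar G Circle)) : Matrix E B ℂ :=
  Matrix.of fun x b => ((b.1 x.1 : Circle) : ℂ)

/-- `(E, B)` is a basis pair: `E` is nonempty, `E` and `B` have the same size, and the characters
in `B`, restricted to `E`, form a basis of `L²(E)`. -/
def IsBasisPair (E : Finset G) (B : Finset (AddChar G Circle)) : Prop :=
  E.Nonempty ∧ B.card = E.card ∧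
    LinearIndependent ℂ (fun b : B => fun x : E => ((b.1 x.1 : Circle) : ℂ)) ∧
    Submodule.span ℂ (Set.range fun b : B => fun x : E => ((b.1 x.1 : Circle) : ℂ)) = ⊤

/-- `B` is a simultaneous basis for a family of subsets. -/
def IsSimultaneousBasis {ι : Type*} (F : ι → Finset G) (B : Finset (AddChar G Circle)) : Prop :=
  ∀ i, IsBasisPair (F i) B

/-- The squared norm `‖∑ b ∈ B, c b • b‖²` in `L²(E)`. -/
def normSqComb (E : Finset G) (B : Finset (AddChar G Circle)) (c : B → ℂ) : ℝ :=
  ∑ x : E, ‖∑ b : B, c b * ((b.1 x.1 : Circle) : ℂ)‖ ^ 2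

/-- The optimal lower Riesz constant `L_E(B)`: the supremum of all `A` with
`A ∑ |c_b|² ≤ ‖∑ c_b b‖²` for all coefficients. -/
def lowerRiesz (E : Finset G) (B : Finset (AddChar G Circle)) : ℝ :=
  sSup {A : ℝ | ∀ c : B → ℂ, A * ∑ b, ‖c b‖ ^ 2 ≤ normSqComb E B c}

/-- The optimal upper Riesz constant `U_E(B)`: the infimum of all `A` with
`‖∑ c_b b‖² ≤ A ∑ |c_b|²` for all coefficients. -/
def upperRiesz (E : Finset G) (B : Finset (AddChar G Circle)) : ℝ :=
  sInf {A : ℝ | ∀ c : B → ℂ, normSqComb E B c ≤ A * ∑ b, ‖c b‖ ^ 2}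

/-- The absolute determinant `D_E(B) = |det T(E, B)|` of an equal-size pair, computed with some
enumeration of `E` and of `B` (see `absDet_eq` for independence of the enumerations). -/
def absDet (E : Finset G) (B : Finset (AddChar G Circle)) : ℝ :=
  if h : B.card = E.card then
    ‖((fourierMatrix E B).submatrix E.equivFin.symm (B.equivFinOfCardEq h).symm).det‖
  else 0

theorem absDet_eq {n : ℕ} (E : Finset G) (B : Finset (AddChar G Circle))
    (e : Fin n ≃ E) (f : Fin n ≃ B) :
    absDet E B = ‖((fourierMatrix E B).submatrix e f).det‖ := by
  have hE : n = E.card := by simpa using Fintype.card_congr e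
  have hB : n = B.card := by simpa using Fintype.card_congr f
  subst hE
  rw [absDet, dif_pos hB.symm]
  set e' := E.equivFin.symm
  set f' := (B.equivFinOfCardEq hB.symm).symm
  have h1 : (fourierMatrix E B).submatrix e f
      = ((((fourierMatrix E B).submatrix e' f').submatrix (e.trans e'.symm) id).submatrix
          id (f.trans f'.symm)) := by
    ext i j; simp
  rw [h1, Matrix.det_permute', Matrix.det_permute]
  rcases Int.units_eq_one_or (Equiv.Perm.sign (e.trans e'.symm)) with h | h <;>
  rcases Int.units_eq_one_or (Equiv.Perm.sign (f.trans f'.symm)) with h' | h' <;>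
  simp [h, h']

/-! ### Normalized tightness quantities of an equal-size pair

They take values in `[0, ∞]`; in `ℝ≥0∞` a positive number divided by `0` is `∞`. -/

/-- `L̃_E(B) = n / L_E(B)`, where `n = |E|`. -/
def normLowerPair (E : Finset G) (B : Finset (AddChar G Circle)) : ℝ≥0∞ :=
  (E.card : ℝ≥0∞) / ENNReal.ofReal (lowerRiesz E B)

/-- `Ũ_E(B) = U_E(B) / n`, where `n = |E|`. -/
def normUpperPair (E : Finset G) (B : Finset (AddChar G Circle)) : ℝ≥0∞ :=
  ENNReal.ofReal (upperRiesz E B) / (E.card : ℝ≥0∞)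

/-- The Riesz ratio `ρ_E(B) = U_E(B) / L_E(B)`. -/
def rieszRatioPair (E : Finset G) (B : Finset (AddChar G Circle)) : ℝ≥0∞ :=
  ENNReal.ofReal (upperRiesz E B) / ENNReal.ofReal (lowerRiesz E B)

/-- `D̃_E(B) = √n / D_E(B)^(1/n)`, where `n = |E|`. -/
def normDetPair (E : Finset G) (B : Finset (AddChar G Circle)) : ℝ≥0∞ :=
  ENNReal.ofReal (Real.sqrt (E.card : ℝ)) /
    ENNReal.ofReal (absDet E B ^ (1 / (E.card : ℝ)))

/-! ### Normalized tightness quantities of a set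

Each is the minimum over all `B ⊆ Ĝ` with `|B| = |E|`; for finite `G` there are finitely many
such `B` and at least one, so the infimum is a minimum. -/

/-- `L̃(E)`. -/
def normLower (E : Finset G) : ℝ≥0∞ :=
  ⨅ (B : Finset (AddChar G Circle)) (_ : B.card = E.card), normLowerPair E B

/-- `Ũ(E)`. -/
def normUpper (E : Finset G) : ℝ≥0∞ :=
  ⨅ (B : Finset (AddChar G Circle)) (_ : B.card = E.card), normUpperPair E B

/-- The Riesz ratio `ρ(E)`. -/
def rieszRatio (E : Finset G) : ℝ≥0∞ :=
  ⨅ (B : Finset (AddChar G Circle)) (_ : B.card = E.card), rieszRatioPair E B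

/-- `D̃(E)`. -/
def normDet (E : Finset G) : ℝ≥0∞ :=
  ⨅ (B : Finset (AddChar G Circle)) (_ : B.card = E.card), normDetPair E B

/-! ### Multi-tiling and cross sections -/

/-- The translate `E + g`. -/
def translate (E : Finset G) (g : G) : Finset G :=
  E.map (addRightEmbedding g)

theorem mem_translate {E : Finset G} {g x : G} : x ∈ translate E g ↔ x - g ∈ E := by
  simp only [translate, Finset.mem_map, addRightEmbedding_apply]
  exact ⟨by rintro ⟨a, ha, rfl⟩; simpa using ha, fun h => ⟨_, h, by simp⟩⟩

/-- `E` multi-tiles `G` with partner `P` at level `ℓ`: every point of `G` lies in exactly `ℓ` of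
the translates `E + t`, `t ∈ P`. -/
def MultiTiles (E : Finset G) (P : Set G) (ℓ : ℕ) : Prop :=
  ∀ x : G, {t : G | t ∈ P ∧ x ∈ translate E t}.ncard = ℓ

/-- The translated `H`-cross section `(E ∩ (g + H)) - g`, as a subset of `H`, that is
`{h ∈ H | h + g ∈ E}`. -/
def translatedCrossSection (E : Finset G) (H : AddSubgroup G) (g : G) : Finset H :=
  E.preimage (fun h : H => (h : G) + g)
    (Function.Injective.injOn fun _ _ h => Subtype.ext (add_right_cancel h))

theorem mem_translatedCrossSection {E : Finset G} {H : AddSubgroup G} {g : G} {h : H} :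
    h ∈ translatedCrossSection E H g ↔ (h : G) + g ∈ E :=
  Finset.mem_preimage

/-- Equality of finite subsets up to translation. -/
def translationSetoid (A : Type*) [AddCommGroup A] : Setoid (Finset A) where
  r S T := ∃ a : A, T = translate S a
  iseqv :=
    { refl := fun S => ⟨0, by ext x; simp [mem_translate]⟩
      symm := by
        rintro S T ⟨a, rfl⟩
        exact ⟨-a, by ext x; simp [mem_translate]⟩
      trans := by
        rintro S T R ⟨a, rfl⟩ ⟨b, rfl⟩
        exact ⟨a + b, by ext x; simp [mem_translate, sub_sub, add_comm]⟩ }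

/-- The number of distinct translated `H`-cross sections of `E` modulo `H`-translation. (Elements
`g` of the same coset give the same class.) -/
def numCrossSections (E : Finset G) (H : AddSubgroup G) : ℕ :=
  (Set.range fun g : G =>
    (Quotient.mk (translationSetoid H) (translatedCrossSection E H g))).ncard

/-- The translated `H`-cross sections of `E`, for some choice of a representative of every coset
of `H`, have a simultaneous basis in the dual group of `H`. -/
def CrossSectionsHaveSimultaneousBasis (E : Finset G) (H : AddSubgroup G) : Prop :=
  ∃ r : G ⧸ H → G, (∀ c, (QuotientAddGroup.mk (r c) : G ⧸ H) = c) ∧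
    ∃ B : Finset (AddChar H Circle),
      IsSimultaneousBasis (fun c => translatedCrossSection E H (r c)) B

end

end RieszTightness

namespace RieszTightness

/-! Over each coset of `H` the set `E` has exactly `ℓ` points. Given `ℓ` characters of `H`, extend
each to `G` and multiply by all characters of `Q = G ⧸ H`; this gives `ℓ|Q| = |E|` characters of
`G`. Their Fourier matrix on `E` factors as a block diagonal matrix with unimodular `ℓ × ℓ` blocks
`T c` (`c` a coset), times `1 ⊗ W` with `W` the Fourier matrix of `Q` (`exists_lifted_spectrum`).
Since `W* W = |Q|·1`, the Riesz constants are controlled by the eigenvalues of `(T c)* T c`, scaled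
by `|Q|`.

These eigenvalues have sum `ℓ²` and product `|det T c|²`, so AM-GM on all but one of them keeps each
away from `0` and from `ℓ²` once the determinant is bounded below.

The lower bound is arithmetic. A product of nonzero determinants of character values is a nonzero
cyclotomic integer, so some conjugate has modulus at least `1`, and conjugation sends characters to
characters (`exists_conjugate_one_le_norm_prod_det`). Translating a cross section does not change
the modulus of its determinant, so a product over `k` representatives suffices; bounding `k - 1`
factors by Hadamard leaves `|det T c|² ≥ ℓ^(-(k-1)ℓ)` for every `c`. For `D̃` the product runs over
all cosets. -/

theorem prod_le_mean_pow_card {ι : Type*} (s : Finset ι) (z : ι → ℝ) (hz : ∀ i ∈ s, 0 ≤ z i) :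
    ∏ i ∈ s, z i ≤ ((∑ i ∈ s, z i) / s.card) ^ s.card := by
  rcases s.eq_empty_or_nonempty with rfl | hs
  · simp
  have hc : 0 < s.card := hs.card_pos
  have h := Real.geom_mean_le_arith_mean s (fun _ => 1) z (by simp) (by simpa using hc) hz
  simp only [Real.rpow_one, Finset.sum_const, nsmul_eq_mul, mul_one, one_mul] at h
  have hp : 0 ≤ ∏ i ∈ s, z i := Finset.prod_nonneg hz
  calc ∏ i ∈ s, z i = ((∏ i ∈ s, z i) ^ ((s.card : ℝ)⁻¹)) ^ s.card :=
        (Real.rpow_inv_natCast_pow hp hc.ne').symm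
    _ ≤ _ := pow_le_pow_left₀ (by positivity) h _

/-! ### Eigenvalues of `T* T` -/

section Gram

theorem star_dotProduct_self {n : Type*} [Fintype n] (v : n → ℂ) : star v ⬝ᵥ v = ((∑ i, ‖v i‖ ^ 2 : ℝ) : ℂ) := by
  simp [dotProduct, Complex.conj_mul']

variable {n : Type*} [Fintype n] [DecidableEq n] (T : Matrix n n ℂ)

noncomputable def gramEigenvalues : n → ℝ :=
  (Matrix.isHermitian_conjTranspose_mul_self T).eigenvalues

open ComplexOrder in
theorem gramEigenvalues_nonneg (i : n) : 0 ≤ gramEigenvalues T i :=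
  (Matrix.posSemidef_conjTranspose_mul_self T).eigenvalues_nonneg i

theorem prod_gramEigenvalues : ∏ i, gramEigenvalues T i = ‖T.det‖ ^ 2 := by
  have h := (Matrix.isHermitian_conjTranspose_mul_self T).det_eq_prod_eigenvalues
  rw [Matrix.det_mul, Matrix.det_conjTranspose] at h
  have h2 : ((∏ i, gramEigenvalues T i : ℝ) : ℂ) = ((‖T.det‖ ^ 2 : ℝ) : ℂ) := by
    push_cast
    rw [← Complex.conj_mul']
    exact h.symm
  exact_mod_cast h2

theorem sum_gramEigenvalues : ∑ i, gramEigenvalues T i = ∑ i, ∑ j, ‖T i j‖ ^ 2 := by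
  have h := (Matrix.isHermitian_conjTranspose_mul_self T).trace_eq_sum_eigenvalues
  have h2 : ((∑ i, gramEigenvalues T i : ℝ) : ℂ) = ((∑ i, ∑ j, ‖T i j‖ ^ 2 : ℝ) : ℂ) := by
    push_cast
    rw [Finset.sum_comm]
    refine h.symm.trans ?_
    simp [Matrix.trace, Matrix.mul_apply, Complex.conj_mul']
  exact_mod_cast h2

theorem exists_gram_coordinates (v : n → ℂ) :
    ∃ w : n → ℂ, ∑ i, ‖w i‖ ^ 2 = ∑ i, ‖v i‖ ^ 2 ∧
      ∑ i, ‖(T.mulVec v) i‖ ^ 2 = ∑ i, gramEigenvalues T i * ‖w i‖ ^ 2 := by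
  have hA := Matrix.isHermitian_conjTranspose_mul_self T
  set U : Matrix n n ℂ := (hA.eigenvectorUnitary : Matrix n n ℂ) with hU
  have hUU : U * star U = 1 := Unitary.coe_mul_star_self _
  have hs : T.conjTranspose * T
      = U * Matrix.diagonal (fun i => (gramEigenvalues T i : ℂ)) * star U := by
    have := hA.spectral_theorem
    rw [Unitary.conjStarAlgAut_apply] at this
    exact this
  have hstar : ∀ x : n → ℂ, star ((star U).mulVec x) = Matrix.vecMul (star x) U := by
    intro x
    rw [Matrix.star_mulVec, Matrix.star_eq_conjTranspose, Matrix.conjTranspose_conjTranspose]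
  refine ⟨(star U).mulVec v, ?_, ?_⟩
  · have : ((∑ i, ‖(star U).mulVec v i‖ ^ 2 : ℝ) : ℂ) = ((∑ i, ‖v i‖ ^ 2 : ℝ) : ℂ) := by
      rw [← star_dotProduct_self, ← star_dotProduct_self, hstar, ← Matrix.dotProduct_mulVec,
        Matrix.mulVec_mulVec, hUU, Matrix.one_mulVec]
    exact_mod_cast this
  · have : ((∑ i, ‖T.mulVec v i‖ ^ 2 : ℝ) : ℂ)
        = ((∑ i, gramEigenvalues T i * ‖(star U).mulVec v i‖ ^ 2 : ℝ) : ℂ) := by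
      rw [← star_dotProduct_self, Matrix.star_mulVec, ← Matrix.dotProduct_mulVec,
        Matrix.mulVec_mulVec, hs, ← Matrix.mulVec_mulVec, ← Matrix.mulVec_mulVec,
        Matrix.dotProduct_mulVec, ← hstar]
      simp only [dotProduct, Matrix.mulVec_diagonal, Pi.star_apply, RCLike.star_def]
      push_cast
      refine Finset.sum_congr rfl fun i _ => ?_
      rw [← Complex.conj_mul']
      ring
    exact_mod_cast this

theorem mul_sum_sq_le_of_le_gramEigenvalues {a : ℝ} (ha : ∀ i, a ≤ gramEigenvalues T i)
    (v : n → ℂ) : a * ∑ i, ‖v i‖ ^ 2 ≤ ∑ i, ‖(T.mulVec v) i‖ ^ 2 := by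
  obtain ⟨w, hw, hT⟩ := exists_gram_coordinates T v
  rw [hT, ← hw, Finset.mul_sum]
  exact Finset.sum_le_sum fun i _ => mul_le_mul_of_nonneg_right (ha i) (by positivity)

theorem sum_sq_le_mul_of_gramEigenvalues_le {a : ℝ} (ha : ∀ i, gramEigenvalues T i ≤ a)
    (v : n → ℂ) : ∑ i, ‖(T.mulVec v) i‖ ^ 2 ≤ a * ∑ i, ‖v i‖ ^ 2 := by
  obtain ⟨w, hw, hT⟩ := exists_gram_coordinates T v
  rw [hT, ← hw, Finset.mul_sum]
  exact Finset.sum_le_sum fun i _ => mul_le_mul_of_nonneg_right (ha i) (by positivity)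

end Gram

/-! ### Eigenvalue bounds for unimodular matrices -/

section Unimodular

variable {ℓ : ℕ} (T : Matrix (Fin ℓ) (Fin ℓ) ℂ)

theorem sum_gramEigenvalues_of_unimodular (hT : ∀ i j, ‖T i j‖ = 1) :
    ∑ i, gramEigenvalues T i = (ℓ : ℝ) ^ 2 := by
  rw [sum_gramEigenvalues]
  simp [hT, sq]

theorem gramEigenvalues_le_of_unimodular (hT : ∀ i j, ‖T i j‖ = 1) (j : Fin ℓ) :
    gramEigenvalues T j ≤ (ℓ : ℝ) ^ 2 := by
  rw [← sum_gramEigenvalues_of_unimodular T hT]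
  exact Finset.single_le_sum (fun i _ => gramEigenvalues_nonneg T i) (Finset.mem_univ j)

/-- Hadamard's inequality for matrices with unimodular entries. -/
theorem norm_det_sq_le_of_unimodular (hT : ∀ i j, ‖T i j‖ = 1) :
    ‖T.det‖ ^ 2 ≤ (ℓ : ℝ) ^ ℓ := by
  rw [← prod_gramEigenvalues]
  refine (prod_le_mean_pow_card Finset.univ _ fun i _ => gramEigenvalues_nonneg T i).trans ?_
  rw [sum_gramEigenvalues_of_unimodular T hT, Finset.card_fin]
  rcases Nat.eq_zero_or_pos ℓ with rfl | h
  · simp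
  · rw [sq, mul_div_cancel_right₀ _ (by positivity)]

/-- AM-GM applied to the eigenvalues other than the `j`-th, whose sum is `ℓ² - x`. For `ℓ = 1` the
division by zero is harmless, the exponent being `0`. -/
theorem gramEigenvalue_mul_rest (hT : ∀ i j, ‖T i j‖ = 1) (j : Fin ℓ) :
    ‖T.det‖ ^ 2 ≤ gramEigenvalues T j *
      (((ℓ : ℝ) ^ 2 - gramEigenvalues T j) / ((ℓ - 1 : ℕ) : ℝ)) ^ (ℓ - 1) := by
  have h1 := Finset.mul_prod_erase Finset.univ (gramEigenvalues T) (Finset.mem_univ j)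
  have h2 := Finset.add_sum_erase Finset.univ (gramEigenvalues T) (Finset.mem_univ j)
  rw [prod_gramEigenvalues] at h1
  rw [sum_gramEigenvalues_of_unimodular T hT] at h2
  have h3 := prod_le_mean_pow_card (Finset.univ.erase j) (gramEigenvalues T)
    fun i _ => gramEigenvalues_nonneg T i
  rw [Finset.card_erase_of_mem (Finset.mem_univ j), Finset.card_fin,
    eq_sub_iff_add_eq'.2 h2] at h3
  rw [← h1]
  exact mul_le_mul_of_nonneg_left h3 (gramEigenvalues_nonneg T j)

theorem one_lt_gramEigenvalue_mul (hT : ∀ i j, ‖T i j‖ = 1) (K : ℕ)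
    (hD : 1 ≤ ‖T.det‖ ^ 2 * (ℓ : ℝ) ^ (K * ℓ)) (j : Fin ℓ) :
    1 < gramEigenvalues T j * (Real.exp 1 * (ℓ : ℝ) ^ (K * ℓ + (ℓ - 1))) := by
  obtain ⟨m, rfl⟩ : ∃ m, ℓ = m + 1 := ⟨ℓ - 1, by have := j.pos; omega⟩
  have h := gramEigenvalue_mul_rest T hT j
  have hsum := gramEigenvalues_le_of_unimodular T hT j
  simp only [Nat.add_sub_cancel] at h ⊢
  set x := gramEigenvalues T j
  have hx0 : 0 ≤ x := gramEigenvalues_nonneg T j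
  have hx : 0 < x := by
    refine lt_of_le_of_ne hx0 fun h0 => ?_
    rw [← h0, zero_mul] at h
    have : ‖T.det‖ ^ 2 = 0 := le_antisymm h (by positivity)
    rw [this] at hD
    norm_num at hD
  -- With `ℓ = m + 1`, `ℓ²/m = (1 + 1/m) ℓ` and `1 + 1/m ≤ exp (1/m)`. Strictness comes from `x >
  -- 0`, or from `1 < e` when `m = 0`.
  have key : ((((m + 1 : ℕ) : ℝ) ^ 2 - x) / (m : ℝ)) ^ m
      < Real.exp 1 * ((m + 1 : ℕ) : ℝ) ^ m := by
    rcases Nat.eq_zero_or_pos m with rfl | hm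
    · simp
    · have hm' : (0 : ℝ) < m := by exact_mod_cast hm
      have e1 : Real.exp 1 = Real.exp (1 / m) ^ m := by
        rw [← Real.exp_nat_mul]
        congr 1
        field_simp
      rw [e1, ← mul_pow]
      refine pow_lt_pow_left₀ ?_ (div_nonneg (by linarith) hm'.le) hm.ne'
      have h5 : (1 : ℝ) / m + 1 ≤ Real.exp (1 / m) := Real.add_one_le_exp _
      calc (((m + 1 : ℕ) : ℝ) ^ 2 - x) / (m : ℝ) < ((m + 1 : ℕ) : ℝ) ^ 2 / m := by
            gcongr; linarith
        _ = (1 / m + 1) * ((m + 1 : ℕ) : ℝ) := by push_cast; field_simp; ring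
        _ ≤ _ := by gcongr
  calc (1 : ℝ) ≤ ‖T.det‖ ^ 2 * ((m + 1 : ℕ) : ℝ) ^ (K * (m + 1)) := hD
    _ ≤ x * ((((m + 1 : ℕ) : ℝ) ^ 2 - x) / (m : ℝ)) ^ m * ((m + 1 : ℕ) : ℝ) ^ (K * (m + 1)) := by
        gcongr
    _ < x * (Real.exp 1 * ((m + 1 : ℕ) : ℝ) ^ m) * ((m + 1 : ℕ) : ℝ) ^ (K * (m + 1)) := by
        gcongr
    _ = _ := by rw [pow_add]; ring

/-- If `x` were this close to `ℓ²`, the mean `t` of the other eigenvalues would be at most `1 /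
(2^(K+2) ℓ^K)`, making the determinant too small. The powers of `2` come from `ℓ ≤ 2^(ℓ-1)`. -/
theorem gramEigenvalue_lt (hT : ∀ i j, ‖T i j‖ = 1) (hℓ : 1 < ℓ) (K : ℕ)
    (hD : 1 ≤ ‖T.det‖ ^ 2 * (ℓ : ℝ) ^ (K * ℓ)) (j : Fin ℓ) :
    gramEigenvalues T j < (ℓ : ℝ) ^ 2 - ((ℓ : ℝ) - 1) / (2 ^ (K + 2) * (ℓ : ℝ) ^ K) := by
  obtain ⟨m, rfl⟩ : ∃ m, ℓ = m + 1 := ⟨ℓ - 1, by omega⟩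
  have h := gramEigenvalue_mul_rest T hT j
  have hsum := gramEigenvalues_le_of_unimodular T hT j
  simp only [Nat.add_sub_cancel] at h ⊢
  set x := gramEigenvalues T j
  have hx0 : 0 ≤ x := gramEigenvalues_nonneg T j
  have hm : 0 < m := by omega
  have hm' : (0 : ℝ) < m := by exact_mod_cast hm
  set L : ℝ := ((m + 1 : ℕ) : ℝ) with hL
  have hL1 : L - 1 = m := by rw [hL]; push_cast; ring
  have hLpos : 0 < L := by rw [hL]; positivity
  rw [hL1]
  by_contra! hcon
  set t := (L ^ 2 - x) / (m : ℝ) with ht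
  have ht0 : 0 ≤ t := div_nonneg (by linarith) hm'.le
  have htpos : 0 < t := by
    refine lt_of_le_of_ne ht0 fun h0 => ?_
    rw [← h0, zero_pow hm.ne', mul_zero] at h
    have : ‖T.det‖ ^ 2 = 0 := le_antisymm h (by positivity)
    rw [this] at hD
    norm_num at hD
  have hxlt : x < L ^ 2 := by
    have : 0 < L ^ 2 - x := by
      have := mul_pos htpos hm'
      rwa [ht, div_mul_cancel₀ _ hm'.ne'] at this
    linarith
  have ht1 : t ≤ 1 / (2 ^ (K + 2) * L ^ K) := by
    rw [ht, div_le_iff₀ hm']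
    have : (m : ℝ) / (2 ^ (K + 2) * L ^ K) = 1 / (2 ^ (K + 2) * L ^ K) * m := by ring
    linarith
  have h2 : L ≤ 2 ^ m := by
    rw [hL]
    exact_mod_cast Nat.lt_two_pow_self (n := m)
  have h3 : t ^ m * (L ^ (K + 2) * L ^ (K * m)) ≤ 1 := by
    calc t ^ m * (L ^ (K + 2) * L ^ (K * m))
        ≤ (1 / (2 ^ (K + 2) * L ^ K)) ^ m * ((2 ^ m) ^ (K + 2) * L ^ (K * m)) := by gcongr
      _ = 1 := by
          rw [div_pow, one_pow, mul_pow, ← pow_mul, ← pow_mul, ← pow_mul, mul_comm m (K + 2)]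
          field_simp
  have h4 : x * t ^ m * L ^ (K * (m + 1)) < 1 := by
    calc x * t ^ m * L ^ (K * (m + 1)) < L ^ 2 * t ^ m * L ^ (K * (m + 1)) := by gcongr
      _ = t ^ m * (L ^ (K + 2) * L ^ (K * m)) := by ring
      _ ≤ 1 := h3
  have h5 : ‖T.det‖ ^ 2 * L ^ (K * (m + 1)) ≤ x * t ^ m * L ^ (K * (m + 1)) := by gcongr
  linarith

end Unimodular

/-! ### Galois conjugation of characters -/

section Conjugates

variable {A : Type*} [AddCommGroup A] [Finite A]

/-- The matrix `[b_s(x_r)]`. -/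
noncomputable def charMatrix {m n : Type*} (x : m → A) (b : n → AddChar A Circle) : Matrix m n ℂ :=
  Matrix.of fun r s => ((b s (x r) : Circle) : ℂ)

omit [Finite A] in
theorem norm_charMatrix {m n : Type*} (x : m → A) (b : n → AddChar A Circle) (r : m) (s : n) :
    ‖charMatrix x b r s‖ = 1 := by
  exact Circle.norm_coe _

/-- If all the determinants `det [b_s(x_{i,r})]` are nonzero, the characters may be replaced by a
Galois conjugate family for which the product of the determinants has modulus at least `1`. -/
theorem exists_conjugate_one_le_norm_prod_det {ι n : Type*} [Fintype ι] [Fintype n]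
    [DecidableEq n] (x : ι → n → A) (b : n → AddChar A Circle)
    (hdet : ∀ i, (charMatrix (x i) b).det ≠ 0) :
    ∃ b' : n → AddChar A Circle, 1 ≤ ‖∏ i, (charMatrix (x i) b').det‖ := by
  set N := Nat.card A with hN
  have : NeZero N := ⟨Nat.card_pos.ne'⟩
  obtain ⟨K, _, _, ζ, hζ⟩ : ∃ (K : Type) (_ : Field K) (_ : NumberField K) (ζ : K),
      IsPrimitiveRoot ζ N := by
    refine
    ⟨CyclotomicField N ℚ, inferInstance, inferInstance,
      (CyclotomicField.isCyclotomicExtension N ℚ).exists_isPrimitiveRoot rfl (NeZero.ne N)⟩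
  obtain ⟨σ₀⟩ : Nonempty (K →+* ℂ) := inferInstance
  have hσ₀ : IsPrimitiveRoot (σ₀ ζ) N := hζ.map_of_injective σ₀.injective
  have hroot : ∀ (s : n) (a : A), ∃ e : ℕ, (σ₀ ζ) ^ e = ((b s a : Circle) : ℂ) := by
    intro s a
    have h1 : ((b s a : Circle) : ℂ) ^ N = 1 := by
      rw [← Circle.coe_pow, ← AddChar.map_nsmul_eq_pow, hN, card_nsmul_eq_zero',
        AddChar.map_zero_eq_one, Circle.coe_one]
    obtain ⟨e, -, he⟩ := hσ₀.eq_pow_of_pow_eq_one h1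
    exact ⟨e, he⟩
  choose e he using hroot
  -- `σ₀ α` is the given product of determinants; any other embedding `σ` replaces `σ₀ ζ` by `σ ζ`
  -- in every entry.
  let α : K := ∏ i, (Matrix.of fun r s => ζ ^ e s (x i r)).det
  have hmap : ∀ σ : K →+* ℂ, σ α = ∏ i, (Matrix.of fun r s => (σ ζ) ^ e s (x i r)).det := by
    intro σ
    simp only [α, map_prod, RingHom.map_det]
    refine Finset.prod_congr rfl fun i _ => ?_
    congr 1
    ext r s
    simp
  have hint : IsIntegral ℤ α := by
    refine IsIntegral.prod _ fun i _ => IsIntegral.det fun r s => ?_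
    exact (hζ.isIntegral (NeZero.pos N)).pow _
  have hne : α ≠ 0 := by
    intro h0
    have h1 := hmap σ₀
    rw [h0, map_zero] at h1
    refine Finset.prod_ne_zero_iff.2 (fun i _ => ?_) h1.symm
    simpa only [he] using! hdet i
  obtain ⟨σ, hσ⟩ : ∃ σ : K →+* ℂ, 1 ≤ ‖σ α‖ :=
    NumberField.exists_conjugate_one_le_norm (K := K) (α := ⟨α, hint⟩)
      (fun h => hne (congrArg Subtype.val h))
  -- The character identities hold for powers of `ζ` by injectivity of `σ₀`, hence also after
  -- applying `σ`.
  let c : n → AddChar A ℂ := fun s =>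
    { toFun := fun a => (σ ζ) ^ e s a
      map_zero_eq_one' := by
        have h1 : ζ ^ e s 0 = 1 := σ₀.injective (by rw [map_pow, he]; simp)
        rw [← map_pow, h1, map_one]
      map_add_eq_mul' := fun a a' => by
        have h1 : ζ ^ e s (a + a') = ζ ^ e s a * ζ ^ e s a' :=
          σ₀.injective (by simp only [map_pow, map_mul, he, AddChar.map_add_eq_mul]; simp)
        rw [← map_pow, h1, map_mul, map_pow, map_pow] }
  refine ⟨fun s => AddChar.circleEquivComplex.symm (c s), ?_⟩
  rw [hmap] at hσ
  exact hσ

end Conjugates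

/-! ### Extension and orthogonality of characters -/

section Extension

variable {G : Type*} [AddCommGroup G] [Finite G]

theorem exists_extension_addChar (H : AddSubgroup G) (b : AddChar H Circle) :
    ∃ β : AddChar G Circle, ∀ h : H, β h = b h := by
  obtain ⟨φ, hφ⟩ := MonoidHom.domRestrict_surjective (G := Multiplicative G) ℂ
    (AddSubgroup.toSubgroup H)
    (MonoidHom.toHomUnits (AddChar.circleEquivComplex b).toMonoidHom)
  let c : AddChar G ℂ := AddChar.toMonoidHomEquiv.symm ((Units.coeHom ℂ).comp φ)
  refine ⟨AddChar.circleEquivComplex.symm c, fun h => ?_⟩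
  ext
  have := congrArg (fun ψ => ((ψ (Multiplicative.ofAdd h) : ℂˣ) : ℂ)) hφ
  exact this

theorem exists_equiv_addChar_circle (Q : Type*) [AddCommGroup Q] [Finite Q] :
    Nonempty (Q ≃ AddChar Q Circle) := by
  cases nonempty_fintype Q
  exact ⟨(Fintype.equivOfCardEq AddChar.card_eq.symm).trans
    AddChar.circleEquivComplex.symm.toEquiv⟩

theorem sum_conj_mul_addChar {Q : Type*} [AddCommGroup Q] [Fintype Q]
    [DecidableEq (AddChar Q Circle)] (χ ψ : AddChar Q Circle) :
    ∑ q, (starRingEnd ℂ) (χ q : ℂ) * (ψ q : ℂ) = if χ = ψ then (Fintype.card Q : ℂ) else 0 := by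
  have h := AddChar.wInner_cWeight_eq_boole (R := ℂ) (AddChar.circleEquivComplex χ)
    (AddChar.circleEquivComplex ψ)
  rw [RCLike.wInner_cWeight_eq_expect, Finset.expect_eq_sum_div_card] at h
  simp only [EmbeddingLike.apply_eq_iff_eq, RCLike.inner_apply] at h
  rw [div_eq_iff (by simp)] at h
  simp only [ite_mul, one_mul, zero_mul, Finset.card_univ] at h
  rw [← h]
  refine Finset.sum_congr rfl fun q _ => ?_
  rw [mul_comm]
  rfl

end Extension

/-! ### Block diagonal times Kronecker factorization -/

section Tensor

variable {ℓ : ℕ} {Q : Type*} [Fintype Q] [DecidableEq Q]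

/-- The matrix with entries `W c q * T_c i j`. -/
def fiberMatrix (W : Matrix Q Q ℂ) (T : Q → Matrix (Fin ℓ) (Fin ℓ) ℂ) :
    Matrix (Fin ℓ × Q) (Fin ℓ × Q) ℂ :=
  Matrix.of fun p p' => W p.2 p'.2 * T p.2 p.1 p'.1

variable {W : Matrix Q Q ℂ} (T : Q → Matrix (Fin ℓ) (Fin ℓ) ℂ)

theorem fiberMatrix_eq :
    fiberMatrix W T = Matrix.blockDiagonal T * Matrix.kronecker (1 : Matrix (Fin ℓ) (Fin ℓ) ℂ) W := by
  ext ⟨i, c⟩ ⟨j, q⟩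
  simp [fiberMatrix, Matrix.mul_apply, Matrix.blockDiagonal_apply, Fintype.sum_prod_type,
    Matrix.one_apply, mul_comm]

theorem norm_det_sq_of_gram_eq (hW : W.conjTranspose * W = (Fintype.card Q : ℂ) • 1) :
    ‖W.det‖ ^ 2 = (Fintype.card Q : ℝ) ^ Fintype.card Q := by
  have h := congrArg Matrix.det hW
  rw [Matrix.det_mul, Matrix.det_conjTranspose, Matrix.det_smul, Matrix.det_one, mul_one,
    RCLike.star_def, Complex.conj_mul'] at h
  exact_mod_cast h

theorem norm_det_fiberMatrix_sq (hW : W.conjTranspose * W = (Fintype.card Q : ℂ) • 1) :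
    ‖(fiberMatrix W T).det‖ ^ 2
      = (Fintype.card Q : ℝ) ^ (Fintype.card Q * ℓ) * ‖∏ c, (T c).det‖ ^ 2 := by
  rw [fiberMatrix_eq, Matrix.det_mul, Matrix.det_blockDiagonal, Matrix.kronecker,
    Matrix.det_kronecker, Matrix.det_one, one_pow, one_mul, Fintype.card_fin, norm_mul, norm_pow,
    mul_pow, ← pow_mul, mul_comm ℓ 2, pow_mul, norm_det_sq_of_gram_eq hW, ← pow_mul, mul_comm]

theorem sum_sq_mulVec_of_gram_eq (hW : W.conjTranspose * W = (Fintype.card Q : ℂ) • 1)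
    (v : Q → ℂ) : ∑ c, ‖W.mulVec v c‖ ^ 2 = Fintype.card Q * ∑ q, ‖v q‖ ^ 2 := by
  have : ((∑ c, ‖W.mulVec v c‖ ^ 2 : ℝ) : ℂ) = ((Fintype.card Q * ∑ q, ‖v q‖ ^ 2 : ℝ) : ℂ) := by
    rw [← star_dotProduct_self, Matrix.star_mulVec, ← Matrix.dotProduct_mulVec,
      Matrix.mulVec_mulVec, hW, Matrix.smul_mulVec, Matrix.one_mulVec, dotProduct_smul,
      star_dotProduct_self]
    simp
  exact_mod_cast this

omit [DecidableEq Q] in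
theorem fiberMatrix_mulVec (v : Fin ℓ × Q → ℂ) (i : Fin ℓ) (c : Q) :
    (fiberMatrix W T).mulVec v (i, c)
      = (T c).mulVec (fun j => W.mulVec (fun q => v (j, q)) c) i := by
  simp only [Matrix.mulVec, dotProduct, fiberMatrix, Matrix.of_apply, Fintype.sum_prod_type,
    Finset.mul_sum]
  exact Finset.sum_congr rfl fun j _ => Finset.sum_congr rfl fun q _ => by ring

theorem sum_sq_partial_transform (hW : W.conjTranspose * W = (Fintype.card Q : ℂ) • 1)
    (v : Fin ℓ × Q → ℂ) :
    ∑ c, ∑ j, ‖W.mulVec (fun q => v (j, q)) c‖ ^ 2 = Fintype.card Q * ∑ p, ‖v p‖ ^ 2 := by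
  rw [Finset.sum_comm, Fintype.sum_prod_type, Finset.mul_sum]
  exact Finset.sum_congr rfl fun j _ => sum_sq_mulVec_of_gram_eq hW _

/-- Transforming along `Q` by `W` multiplies the squared norm by `|Q|`; the blocks `T c` then act
independently, each with constant `a`. -/
theorem lower_bound_fiberMatrix (hW : W.conjTranspose * W = (Fintype.card Q : ℂ) • 1) {a : ℝ}
    (ha : ∀ c w, a * ∑ j, ‖w j‖ ^ 2 ≤ ∑ i, ‖(T c).mulVec w i‖ ^ 2) (v : Fin ℓ × Q → ℂ) :
    a * Fintype.card Q * ∑ p, ‖v p‖ ^ 2 ≤ ∑ p, ‖(fiberMatrix W T).mulVec v p‖ ^ 2 := by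
  rw [mul_assoc, ← sum_sq_partial_transform hW, Fintype.sum_prod_type_right, Finset.mul_sum]
  simp only [fiberMatrix_mulVec]
  exact Finset.sum_le_sum fun c _ => ha c _

theorem upper_bound_fiberMatrix (hW : W.conjTranspose * W = (Fintype.card Q : ℂ) • 1) {a : ℝ}
    (ha : ∀ c w, ∑ i, ‖(T c).mulVec w i‖ ^ 2 ≤ a * ∑ j, ‖w j‖ ^ 2) (v : Fin ℓ × Q → ℂ) :
    ∑ p, ‖(fiberMatrix W T).mulVec v p‖ ^ 2 ≤ a * Fintype.card Q * ∑ p, ‖v p‖ ^ 2 := by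
  rw [mul_assoc, ← sum_sq_partial_transform hW, Fintype.sum_prod_type_right, Finset.mul_sum]
  simp only [fiberMatrix_mulVec]
  exact Finset.sum_le_sum fun c _ => ha c _

end Tensor

/-! ### Riesz constants and determinants in coordinates -/

section PairBounds

variable {G : Type*} [AddCommGroup G] {E : Finset G} {B : Finset (AddChar G Circle)}
  {m : Type*} [Fintype m] (e : m ≃ E) (f : m ≃ B)

theorem normSqComb_eq (c : B → ℂ) :
    normSqComb E B c
      = ∑ p, ‖((fourierMatrix E B).submatrix e f).mulVec (fun p => c (f p)) p‖ ^ 2 := by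
  rw [normSqComb, ← Equiv.sum_comp e]
  refine Finset.sum_congr rfl fun p _ => ?_
  rw [← Equiv.sum_comp f]
  simp [Matrix.mulVec, dotProduct, fourierMatrix, mul_comm]

theorem le_lowerRiesz [Nonempty m] {a : ℝ}
    (ha : ∀ v : m → ℂ, a * ∑ p, ‖v p‖ ^ 2
      ≤ ∑ p, ‖((fourierMatrix E B).submatrix e f).mulVec v p‖ ^ 2) :
    a ≤ lowerRiesz E B := by
  have hB : 0 < Fintype.card B := by
    rw [← Fintype.card_congr f]; exact Fintype.card_pos
  -- The set of admissible constants is bounded above by testing the all-ones vector, as `B` is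
  -- nonempty.
  refine le_csSup ⟨normSqComb E B (fun _ => 1) / Fintype.card B, fun A hA => ?_⟩ fun c => ?_
  · have := hA fun _ => 1
    rw [le_div_iff₀ (by exact_mod_cast hB)]
    simpa using this
  · rw [normSqComb_eq e f, ← Equiv.sum_comp f]
    exact ha _

theorem upperRiesz_le [Nonempty m] {a : ℝ}
    (ha : ∀ v : m → ℂ, ∑ p, ‖((fourierMatrix E B).submatrix e f).mulVec v p‖ ^ 2
      ≤ a * ∑ p, ‖v p‖ ^ 2) :
    upperRiesz E B ≤ a := by
  have hB : 0 < Fintype.card B := by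
    rw [← Fintype.card_congr f]; exact Fintype.card_pos
  refine csInf_le ⟨0, fun A hA => ?_⟩ fun c => ?_
  · have h1 := hA fun _ => 1
    have h0 : 0 ≤ normSqComb E B fun _ => 1 := Finset.sum_nonneg fun _ _ => by positivity
    refine nonneg_of_mul_nonneg_left (b := (Fintype.card B : ℝ)) ?_ (by exact_mod_cast hB)
    simpa using h0.trans h1
  · rw [normSqComb_eq e f, ← Equiv.sum_comp f]
    exact ha _

theorem absDet_eq_norm_det [DecidableEq m] :
    absDet E B = ‖((fourierMatrix E B).submatrix e f).det‖ := by
  let g : Fin (Fintype.card m) ≃ m := (Fintype.equivFin m).symm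
  rw [absDet_eq E B (g.trans e) (g.trans f), ← Matrix.det_submatrix_equiv_self g]
  rfl

end PairBounds

/-! ### Determinants of character matrices -/

section CharMatrix

variable {A : Type*} [AddCommGroup A] {n : Type*} [Fintype n] [DecidableEq n]

theorem norm_det_mul_row (M : Matrix n n ℂ) (u : n → ℂ) (hu : ∀ j, ‖u j‖ = 1) :
    ‖(Matrix.of fun i j => u j * M i j).det‖ = ‖M.det‖ := by
  rw [Matrix.det_mul_row, norm_mul, norm_prod]
  simp [hu]

/-- Translation by `a` multiplies column `j` by the unimodular number `b j a`. -/
theorem norm_det_charMatrix_add (x : n → A) (b : n → AddChar A Circle) (a : A) :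
    ‖(charMatrix (fun i => x i + a) b).det‖ = ‖(charMatrix x b).det‖ := by
  rw [← norm_det_mul_row (charMatrix x b) (fun j => ((b j a : Circle) : ℂ))
    fun j => Circle.norm_coe _]
  congr 2
  ext i j
  simp [charMatrix, AddChar.map_add_eq_mul, mul_comm]

theorem injective_of_det_charMatrix_ne_zero {x : n → A} {b : n → AddChar A Circle}
    (h : (charMatrix x b).det ≠ 0) : Function.Injective b := by
  intro j j' hj
  by_contra hne
  refine h (Matrix.det_zero_of_column_eq hne fun i => ?_)
  simp [charMatrix, hj]

theorem det_charMatrix_ne_zero_of_isBasisPair {F : Finset A} {B : Finset (AddChar A Circle)}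
    (h : IsBasisPair F B) (e : n ≃ F) (f : n ≃ B) :
    (charMatrix (fun i => (e i : A)) fun j => (f j : AddChar A Circle)).det ≠ 0 := by
  have h1 := (h.2.2.1.comp f f.injective).map' (LinearEquiv.funCongrLeft ℂ ℂ e).toLinearMap
    (LinearEquiv.ker _)
  rw [← isUnit_iff_ne_zero, ← Matrix.isUnit_iff_isUnit_det,
    ← Matrix.linearIndependent_cols_iff_isUnit]
  exact h1

end CharMatrix

/-! ### Lifting characters from `H` to `G` -/

section Lift

variable {G : Type*} [AddCommGroup G] [Finite G]

open Classical in
/-- Lifting characters of `H` in all possible ways gives a spectrum for `E` whose Fourier matrix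
is assembled from those of the cross sections. -/
theorem exists_lifted_spectrum {E : Finset G} {H : AddSubgroup G} [Fintype (G ⧸ H)] {ℓ : ℕ}
    {r : G ⧸ H → G}
    (hr : ∀ c, (QuotientAddGroup.mk (r c) : G ⧸ H) = c) {x : G ⧸ H → Fin ℓ → H}
    (hx : ∀ c, Function.Injective (x c))
    (hxE : ∀ c (h : H), (h : G) + r c ∈ E ↔ ∃ i, x c i = h)
    {b : Fin ℓ → AddChar H Circle} (hb : Function.Injective b) :
    ∃ (B : Finset (AddChar G Circle)) (e : Fin ℓ × (G ⧸ H) ≃ E) (f : Fin ℓ × (G ⧸ H) ≃ B)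
      (W : Matrix (G ⧸ H) (G ⧸ H) ℂ) (T : G ⧸ H → Matrix (Fin ℓ) (Fin ℓ) ℂ),
      W.conjTranspose * W = (Fintype.card (G ⧸ H) : ℂ) • 1 ∧
      (∀ c i j, ‖T c i j‖ = 1) ∧
      (∀ c, ‖(T c).det‖ = ‖(charMatrix (x c) b).det‖) ∧
      (fourierMatrix E B).submatrix e f = fiberMatrix W T := by
  choose β hβ using fun j => exists_extension_addChar H (b j)
  obtain ⟨χ⟩ := exists_equiv_addChar_circle (G ⧸ H)
  have hH : ∀ h : H, (QuotientAddGroup.mk (h : G) : G ⧸ H) = 0 := fun h =>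
    (QuotientAddGroup.eq_zero_iff _).2 h.2
  let Φ : Fin ℓ × (G ⧸ H) → AddChar G Circle := fun p =>
    β p.1 * (χ p.2).compAddMonoidHom (QuotientAddGroup.mk' H)
  have hΦapp : ∀ p g, Φ p g = β p.1 g * χ p.2 (QuotientAddGroup.mk g) := fun p g => rfl
  -- Restriction to `H` recovers `j`; evaluation at the representatives `r c` then recovers `q`.
  have hΦ : Function.Injective Φ := by
    rintro ⟨j, q⟩ ⟨j', q'⟩ h
    have hj : j = j' := hb <| by
      ext h'
      have := DFunLike.congr_fun h (h' : G)
      simp only [hΦapp, hH, AddChar.map_zero_eq_one, mul_one, hβ] at this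
      rw [this]
    subst hj
    have hq : q = q' := χ.injective <| by
      ext c
      have := DFunLike.congr_fun h (r c)
      simp only [hΦapp, hr] at this
      rw [mul_left_cancel this]
    rw [hq]
  let B : Finset (AddChar G Circle) := Finset.univ.map ⟨Φ, hΦ⟩
  let f : Fin ℓ × (G ⧸ H) ≃ B := Equiv.ofBijective
    (fun p => ⟨Φ p, Finset.mem_map.2 ⟨p, Finset.mem_univ _, rfl⟩⟩)
    ⟨fun p p' h => hΦ (congrArg Subtype.val h), by
      rintro ⟨ψ, hψ⟩
      obtain ⟨p, -, rfl⟩ := Finset.mem_map.1 hψ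
      exact ⟨p, rfl⟩⟩
  let e : Fin ℓ × (G ⧸ H) ≃ E := Equiv.ofBijective
    (fun p => ⟨(x p.2 p.1 : G) + r p.2, (hxE _ _).2 ⟨_, rfl⟩⟩)
    ⟨by
      rintro ⟨i, c⟩ ⟨i', c'⟩ h
      have h1 : (x c i : G) + r c = x c' i' + r c' := congrArg Subtype.val h
      have h2 : c = c' := by
        have := congrArg (QuotientAddGroup.mk (s := H)) h1
        simpa only [QuotientAddGroup.mk_add, hH, hr, zero_add] using this
      subst h2
      rw [hx c (Subtype.ext (add_right_cancel h1))],
    by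
      rintro ⟨g, hg⟩
      have hmem : g - r (QuotientAddGroup.mk g) ∈ H := by
        rw [← QuotientAddGroup.eq_zero_iff, QuotientAddGroup.mk_sub, hr, sub_self]
      obtain ⟨i, hi⟩ := (hxE (QuotientAddGroup.mk g) ⟨_, hmem⟩).1 (by simpa using hg)
      exact ⟨(i, QuotientAddGroup.mk g), Subtype.ext (by simp [hi])⟩⟩
  -- At the point `x c i + r c` the character `Φ (j, q)` takes the value `b j (x c i) * β j (r c) *
  -- χ q c`; the middle factor is absorbed into column `j` of `T c`.
  refine ⟨B, e, f, Matrix.of fun c q => ((χ q c : Circle) : ℂ),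
    fun c => Matrix.of fun i j => ((β j (r c) : Circle) : ℂ) * charMatrix (x c) b i j,
    ?_, ?_, ?_, ?_⟩
  · ext q q'
    rw [Matrix.mul_apply]
    simp only [Matrix.conjTranspose_apply, Matrix.of_apply, RCLike.star_def,
      sum_conj_mul_addChar, Matrix.smul_apply, Matrix.one_apply, EmbeddingLike.apply_eq_iff_eq]
    simp
  · intro c i j
    exact ((norm_mul _ _).trans (congrArg₂ (· * ·) (Circle.norm_coe _)
      (norm_charMatrix _ _ _ _))).trans (mul_one 1)
  · intro c
    exact norm_det_mul_row _ _ fun j => Circle.norm_coe _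
  · ext ⟨i, c⟩ ⟨j, q⟩
    change ((Φ (j, q) ((x c i : G) + r c) : Circle) : ℂ) = _
    simp only [hΦapp, QuotientAddGroup.mk_add, hH, hr, zero_add, AddChar.map_add_eq_mul, hβ,
      fiberMatrix, Matrix.of_apply, charMatrix, Circle.coe_mul]
    ring

end Lift

/-! ### Cross sections of a multi-tile -/

section CrossSections

variable {G : Type*} [AddCommGroup G] {E : Finset G} {H : AddSubgroup G} {ℓ : ℕ}

/-- The translates of `E` by elements of `H` that contain `g` are those by `-h` with `h` in the
section at `g`. -/
theorem card_translatedCrossSection (hE : MultiTiles E (H : Set G) ℓ) (g : G) :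
    (translatedCrossSection E H g).card = ℓ := by
  rw [← hE g, ← Set.ncard_coe_finset,
    ← Set.ncard_image_of_injective _ (f := fun h : H => -(h : G))
      fun _ _ h => Subtype.ext (neg_injective h)]
  congr 1
  ext t
  simp only [Set.mem_image, mem_translatedCrossSection, mem_translate,
    Set.mem_ofPred_eq, SetLike.mem_coe]
  constructor
  · rintro ⟨h, hh, rfl⟩
    exact ⟨H.neg_mem h.2, by rwa [sub_neg_eq_add, add_comm]⟩
  · rintro ⟨ht, hg⟩
    exact ⟨⟨-t, H.neg_mem ht⟩, by rwa [neg_add_eq_sub], neg_neg t⟩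

theorem translatedCrossSection_rel {g g' : G}
    (h : (QuotientAddGroup.mk g : G ⧸ H) = QuotientAddGroup.mk g') :
    (translationSetoid H).r (translatedCrossSection E H g) (translatedCrossSection E H g') := by
  refine ⟨⟨g - g', by rw [← QuotientAddGroup.eq_zero_iff, QuotientAddGroup.mk_sub, h, sub_self]⟩, ?_⟩
  ext y
  simp only [mem_translatedCrossSection, mem_translate, AddSubgroup.coe_sub]
  rw [show (y : G) - (g - g') + g = y + g' by abel]

end CrossSections

/-! ### Tightness of the lifted pair -/

section FiberBounds

variable {G : Type*} [AddCommGroup G] {E : Finset G} {B : Finset (AddChar G Circle)}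
  {Q : Type*} [Fintype Q] [DecidableEq Q] [Nonempty Q] {ℓ : ℕ}
  {e : Fin ℓ × Q ≃ E} {f : Fin ℓ × Q ≃ B}
  {W : Matrix Q Q ℂ} {T : Q → Matrix (Fin ℓ) (Fin ℓ) ℂ}

omit [AddCommGroup G] [DecidableEq Q] [Nonempty Q] in
theorem card_eq_mul (e : Fin ℓ × Q ≃ E) : E.card = ℓ * Fintype.card Q := by
  simpa using (Fintype.card_congr e).symm

/-- The squared determinant is `|Q|^n` times `‖∏ det T c‖²`, with `n = ℓ|Q|`, so its `n`-th root
gives `D^(1/n) ≥ √|Q|`. -/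
theorem normDetPair_le (hℓ : 1 ≤ ℓ) (hW : W.conjTranspose * W = (Fintype.card Q : ℂ) • 1)
    (hM : (fourierMatrix E B).submatrix e f = fiberMatrix W T)
    (hD : 1 ≤ ‖∏ c, (T c).det‖) :
    normDetPair E B ≤ ENNReal.ofReal (Real.sqrt ℓ) := by
  have hq : (0 : ℝ) < Fintype.card Q := by exact_mod_cast Fintype.card_pos
  set q := Fintype.card Q
  have hn : E.card ≠ 0 := by
    rw [card_eq_mul e]; exact (Nat.mul_pos hℓ Fintype.card_pos).ne'
  have h1 : (Real.sqrt q) ^ E.card ≤ absDet E B := by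
    rw [absDet_eq_norm_det e f, hM]
    refine (sq_le_sq₀ (by positivity) (norm_nonneg _)).1 ?_
    rw [norm_det_fiberMatrix_sq T hW, ← pow_mul, mul_comm E.card 2, pow_mul, Real.sq_sqrt hq.le,
      card_eq_mul e, mul_comm ℓ]
    exact le_mul_of_one_le_right (by positivity) (one_le_pow₀ hD)
  have h2 : Real.sqrt q ≤ absDet E B ^ (1 / (E.card : ℝ)) := by
    rw [one_div, ← Real.pow_rpow_inv_natCast (Real.sqrt_nonneg q) hn]
    exact Real.rpow_le_rpow (by positivity) h1 (by positivity)
  rw [normDetPair]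
  have h3 : 0 < Real.sqrt q := Real.sqrt_pos.2 hq
  rw [← ENNReal.ofReal_div_of_pos (h3.trans_le h2)]
  refine ENNReal.ofReal_le_ofReal ?_
  have h4 : Real.sqrt E.card = Real.sqrt ℓ * Real.sqrt q := by
    rw [card_eq_mul e, Nat.cast_mul, Real.sqrt_mul (by positivity)]
  rw [div_le_iff₀ (h3.trans_le h2), h4]
  gcongr

theorem exists_lowerRiesz_ge (hℓ : 1 ≤ ℓ)
    (hW : W.conjTranspose * W = (Fintype.card Q : ℂ) • 1)
    (hM : (fourierMatrix E B).submatrix e f = fiberMatrix W T) :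
    ∃ c j, gramEigenvalues (T c) j * Fintype.card Q ≤ lowerRiesz E B := by
  have : Nonempty (Fin ℓ) := ⟨⟨0, hℓ⟩⟩
  obtain ⟨p, hmin⟩ := Finite.exists_min fun p : Q × Fin ℓ => gramEigenvalues (T p.1) p.2
  have hp : ∀ c i, gramEigenvalues (T p.1) p.2 ≤ gramEigenvalues (T c) i := fun c i => hmin (c, i)
  refine ⟨p.1, p.2, le_lowerRiesz e f fun v => ?_⟩
  rw [hM]
  exact lower_bound_fiberMatrix T hW (fun c w => mul_sum_sq_le_of_le_gramEigenvalues (T c) (hp c) w) v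

theorem exists_upperRiesz_le (hℓ : 1 ≤ ℓ)
    (hW : W.conjTranspose * W = (Fintype.card Q : ℂ) • 1)
    (hM : (fourierMatrix E B).submatrix e f = fiberMatrix W T) :
    ∃ c j, upperRiesz E B ≤ gramEigenvalues (T c) j * Fintype.card Q := by
  have : Nonempty (Fin ℓ) := ⟨⟨0, hℓ⟩⟩
  obtain ⟨p, hmax⟩ := Finite.exists_max fun p : Q × Fin ℓ => gramEigenvalues (T p.1) p.2
  have hp : ∀ c i, gramEigenvalues (T c) i ≤ gramEigenvalues (T p.1) p.2 := fun c i => hmax (c, i)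
  refine ⟨p.1, p.2, upperRiesz_le e f fun v => ?_⟩
  rw [hM]
  exact upper_bound_fiberMatrix T hW (fun c w => sum_sq_le_mul_of_gramEigenvalues_le (T c) (hp c) w) v

variable (hℓ : 1 ≤ ℓ) (hW : W.conjTranspose * W = (Fintype.card Q : ℂ) • 1)
  (hM : (fourierMatrix E B).submatrix e f = fiberMatrix W T)
  (hT : ∀ c i j, ‖T c i j‖ = 1) {K : ℕ}
  (hD : ∀ c, 1 ≤ ‖(T c).det‖ ^ 2 * (ℓ : ℝ) ^ (K * ℓ))

include hℓ hW hM hT hD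

/-- The least block eigenvalue `a` gives `L ≥ a|Q|`, while `n = ℓ|Q|`; this extra `ℓ` raises the
exponent `Kℓ + (ℓ - 1)` to `(K + 1)ℓ`. In the application `K = k - 1`. -/
theorem normLowerPair_lt :
    normLowerPair E B < ENNReal.ofReal (Real.exp 1 * (ℓ : ℝ) ^ ((K + 1) * ℓ)) := by
  obtain ⟨c, j, h⟩ := exists_lowerRiesz_ge hℓ hW hM
  have h1 := one_lt_gramEigenvalue_mul (T c) (hT c) K (hD c) j
  have hq : (0 : ℝ) < Fintype.card Q := by exact_mod_cast Fintype.card_pos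
  have hℓ' : (0 : ℝ) < ℓ := by exact_mod_cast hℓ
  set a := gramEigenvalues (T c) j
  have ha : 0 < a := by
    by_contra! h0
    exact absurd h1 (not_lt.2 ((mul_nonpos_of_nonpos_of_nonneg h0 (by positivity)).trans zero_le_one))
  have hL := (mul_pos ha hq).trans_le h
  rw [normLowerPair, ← ENNReal.ofReal_natCast, ← ENNReal.ofReal_div_of_pos hL,
    ENNReal.ofReal_lt_ofReal_iff (by positivity), div_lt_iff₀ hL, card_eq_mul e]
  have h2 : (K + 1) * ℓ = K * ℓ + (ℓ - 1) + 1 := by rw [add_mul]; omega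
  calc ((ℓ * Fintype.card Q : ℕ) : ℝ) = 1 * (ℓ * Fintype.card Q) := by push_cast; ring
    _ < a * (Real.exp 1 * (ℓ : ℝ) ^ (K * ℓ + (ℓ - 1))) * (ℓ * Fintype.card Q) := by gcongr
    _ = Real.exp 1 * (ℓ : ℝ) ^ ((K + 1) * ℓ) * (a * Fintype.card Q) := by
        rw [h2, pow_succ]; ring
    _ ≤ _ := by gcongr

/-- Every block eigenvalue is at most `ℓ²`, so `U ≤ ℓ²|Q| = ℓn` and the ratio is at most `ℓ` times
`n / L`. -/
theorem rieszRatioPair_lt :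
    rieszRatioPair E B < ENNReal.ofReal (Real.exp 1 * (ℓ : ℝ) ^ ((K + 1) * ℓ + 1)) := by
  have hL := normLowerPair_lt hℓ hW hM hT hD
  obtain ⟨c, j, h⟩ := exists_upperRiesz_le hℓ hW hM
  have hU : ENNReal.ofReal (upperRiesz E B) ≤ ENNReal.ofReal ℓ * (E.card : ℝ≥0∞) := by
    rw [← ENNReal.ofReal_natCast, ← ENNReal.ofReal_mul (by positivity)]
    refine ENNReal.ofReal_le_ofReal (h.trans ?_)
    calc gramEigenvalues (T c) j * Fintype.card Q ≤ (ℓ : ℝ) ^ 2 * Fintype.card Q := by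
          gcongr; exact gramEigenvalues_le_of_unimodular _ (hT c) j
      _ = _ := by rw [card_eq_mul e]; push_cast; ring
  calc rieszRatioPair E B ≤ ENNReal.ofReal ℓ * normLowerPair E B := by
        rw [rieszRatioPair, normLowerPair, ← mul_div_assoc]
        exact ENNReal.div_le_div_right hU _
    _ < ENNReal.ofReal ℓ * ENNReal.ofReal (Real.exp 1 * (ℓ : ℝ) ^ ((K + 1) * ℓ)) :=
        (ENNReal.mul_lt_mul_iff_right (by simpa using Nat.one_le_iff_ne_zero.1 hℓ) (by simp)).2 hL
    _ = _ := by
        rw [← ENNReal.ofReal_mul (by positivity), pow_succ]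
        congr 1; ring

theorem normUpperPair_lt (hℓ1 : 1 < ℓ) :
    normUpperPair E B <
      ENNReal.ofReal ((ℓ : ℝ) - ((ℓ : ℝ) - 1) / (2 ^ (K + 1 + 1) * (ℓ : ℝ) ^ (K + 1))) := by
  obtain ⟨c, j, h⟩ := exists_upperRiesz_le hℓ hW hM
  have h1 := gramEigenvalue_lt (T c) (hT c) hℓ1 K (hD c) j
  have h0 := gramEigenvalues_nonneg (T c) j
  have hq : (0 : ℝ) < Fintype.card Q := by exact_mod_cast Fintype.card_pos
  have hℓ' : (0 : ℝ) < ℓ := by exact_mod_cast hℓ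
  have hn : (0 : ℝ) < E.card := by rw [card_eq_mul e]; push_cast; positivity
  set a := gramEigenvalues (T c) j
  set R := (ℓ : ℝ) - ((ℓ : ℝ) - 1) / (2 ^ (K + 1 + 1) * (ℓ : ℝ) ^ (K + 1)) with hR
  have hRa : a < R * ℓ := by
    have : R * ℓ = (ℓ : ℝ) ^ 2 - ((ℓ : ℝ) - 1) / (2 ^ (K + 2) * (ℓ : ℝ) ^ K) := by
      rw [hR]
      field_simp
      ring
    rwa [this]
  have hRpos : 0 < R := pos_of_mul_pos_left (h0.trans_lt hRa) hℓ'.le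
  rw [normUpperPair, ← ENNReal.ofReal_natCast, ← ENNReal.ofReal_div_of_pos hn,
    ENNReal.ofReal_lt_ofReal_iff hRpos, div_lt_iff₀ hn, card_eq_mul e]
  calc upperRiesz E B ≤ a * Fintype.card Q := h
    _ < R * ℓ * Fintype.card Q := by gcongr
    _ = _ := by push_cast; ring

end FiberBounds

/-! ### Choice of the spectrum for a multi-tile -/

section MultiTiling

variable {G : Type*} [AddCommGroup G] [Finite G] {E : Finset G} {H : AddSubgroup G} {ℓ : ℕ}

omit [Finite G] in
theorem exists_enumerations (hE : MultiTiles E (H : Set G) ℓ)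
    (hB : CrossSectionsHaveSimultaneousBasis E H) :
    ∃ (r : G ⧸ H → G) (x : G ⧸ H → Fin ℓ → H) (b : Fin ℓ → AddChar H Circle),
      (∀ c, (QuotientAddGroup.mk (r c) : G ⧸ H) = c) ∧
      (∀ c, Function.Injective (x c)) ∧
      (∀ c h, h ∈ translatedCrossSection E H (r c) ↔ ∃ i, x c i = h) ∧
      ∀ c, (charMatrix (x c) b).det ≠ 0 := by
  obtain ⟨r, hr, B, hbasis⟩ := hB
  have hBc : B.card = ℓ := (hbasis 0).2.1.trans (card_translatedCrossSection hE _)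
  let x := fun c => ((translatedCrossSection E H (r c)).equivFinOfCardEq
    (card_translatedCrossSection hE (r c))).symm
  refine ⟨r, fun c i => x c i, fun j => (B.equivFinOfCardEq hBc).symm j, hr,
    fun c => Subtype.val_injective.comp (x c).injective, fun c h => ⟨fun hh => ?_, ?_⟩,
    fun c => det_charMatrix_ne_zero_of_isBasisPair (hbasis c) (x c) _⟩
  · obtain ⟨i, hi⟩ := (x c).surjective ⟨h, hh⟩
    exact ⟨i, congrArg Subtype.val hi⟩
  · rintro ⟨i, rfl⟩
    exact (x c i).2

/-- The conjugate is chosen for the product over all cosets, repeated classes included, since the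
full determinant involves every block. This spectrum may differ from the one behind the other three
bounds. -/
theorem normDet_le (hℓ : 1 ≤ ℓ) (hE : MultiTiles E (H : Set G) ℓ)
    (hB : CrossSectionsHaveSimultaneousBasis E H) :
    normDet E ≤ ENNReal.ofReal (Real.sqrt ℓ) := by
  classical
  cases nonempty_fintype (G ⧸ H)
  obtain ⟨r, x, b, hr, hx, hxE, hdet⟩ := exists_enumerations hE hB
  obtain ⟨b', hb'⟩ := exists_conjugate_one_le_norm_prod_det x b hdet
  have hinj : Function.Injective b' := by
    refine injective_of_det_charMatrix_ne_zero (x := x 0) fun h0 => ?_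
    rw [Finset.prod_eq_zero (Finset.mem_univ 0) h0, norm_zero] at hb'
    norm_num at hb'
  obtain ⟨B, e, f, W, T, hW, hT, hTdet, hM⟩ := exists_lifted_spectrum (E := E) hr hx
    (fun c h => mem_translatedCrossSection.symm.trans (hxE c h)) hinj
  refine (iInf₂_le B ?_).trans (normDetPair_le hℓ hW hM ?_)
  · simpa using Fintype.card_congr (f.symm.trans e)
  · rw [norm_prod] at hb' ⊢
    simpa only [hTdet] using hb'

theorem one_le_norm_sq_mul_of_one_le_norm_prod {ι : Type*} [Fintype ι]
    {d : ι → ℂ} (h : 1 ≤ ‖∏ i, d i‖) {C : ℝ} (hC : ∀ i, ‖d i‖ ^ 2 ≤ C) (i : ι) :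
    1 ≤ ‖d i‖ ^ 2 * C ^ (Fintype.card ι - 1) := by
  classical
  calc (1 : ℝ) ≤ ‖∏ i, d i‖ ^ 2 := one_le_pow₀ h
    _ = ‖d i‖ ^ 2 * ∏ j ∈ Finset.univ.erase i, ‖d j‖ ^ 2 := by
        rw [Finset.mul_prod_erase _ (fun j => ‖d j‖ ^ 2) (Finset.mem_univ i), norm_prod,
          Finset.prod_pow]
    _ ≤ ‖d i‖ ^ 2 * ∏ j ∈ Finset.univ.erase i, C := by
        gcongr with j
        exact hC j
    _ = _ := by
        rw [Finset.prod_const, Finset.card_erase_of_mem (Finset.mem_univ i), Finset.card_univ]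

open Classical in
theorem exists_spectrum_of_numCrossSections (hE : MultiTiles E (H : Set G) ℓ) {k : ℕ}
    (hk : numCrossSections E H = k) (hB : CrossSectionsHaveSimultaneousBasis E H)
    [Fintype (G ⧸ H)] :
    1 ≤ k ∧ ∃ (B : Finset (AddChar G Circle)) (e : Fin ℓ × (G ⧸ H) ≃ E)
      (f : Fin ℓ × (G ⧸ H) ≃ B)
      (W : Matrix (G ⧸ H) (G ⧸ H) ℂ) (T : G ⧸ H → Matrix (Fin ℓ) (Fin ℓ) ℂ),
      W.conjTranspose * W = (Fintype.card (G ⧸ H) : ℂ) • 1 ∧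
      (fourierMatrix E B).submatrix e f = fiberMatrix W T ∧
      (∀ c i j, ‖T c i j‖ = 1) ∧
      ∀ c, 1 ≤ ‖(T c).det‖ ^ 2 * (ℓ : ℝ) ^ ((k - 1) * ℓ) := by
  obtain ⟨r, x, b, hr, hx, hxE, hdet⟩ := exists_enumerations hE hB
  let cls : G → Quotient (translationSetoid H) := fun g =>
    Quotient.mk (translationSetoid H) (translatedCrossSection E H g)
  have hcls : ∀ g, cls (r (QuotientAddGroup.mk g)) = cls g := fun g =>
    Quotient.sound (translatedCrossSection_rel (hr _))
  let S := Set.range cls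
  have : Finite S := Set.finite_range cls
  have : Fintype S := Fintype.ofFinite S
  have hcard : Fintype.card S = k := by
    rw [← hk, numCrossSections, ← Nat.card_eq_fintype_card]
    rfl
  have hrep : ∀ s : S, ∃ c : G ⧸ H, cls (r c) = s := by
    rintro ⟨_, g, rfl⟩
    exact ⟨_, hcls g⟩
  choose ρ hρ using hrep
  obtain ⟨b', hb'⟩ := exists_conjugate_one_le_norm_prod_det (fun s => x (ρ s)) b
    fun s => hdet (ρ s)
  -- One factor per class: Hadamard bounds each of the other `k - 1` squared determinants by `ℓ^ℓ`.
  have hbound := one_le_norm_sq_mul_of_one_le_norm_prod hb'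
    fun s => norm_det_sq_le_of_unimodular _ (norm_charMatrix (x (ρ s)) b')
  rw [hcard] at hbound
  let κ : G ⧸ H → S := fun c => ⟨cls (r c), r c, rfl⟩
  have hshift : ∀ c, ∃ a : H, translatedCrossSection E H (r c)
      = translate (translatedCrossSection E H (r (ρ (κ c)))) a := fun c =>
    Quotient.exact (hρ (κ c))
  choose a ha using hshift
  have hinj : Function.Injective b' := by
    refine injective_of_det_charMatrix_ne_zero (x := x (ρ (κ 0))) fun h0 => ?_
    have := hbound (κ 0)
    rw [h0] at this
    norm_num at this
  -- Each section is enumerated as a translate of its class representative, so that its determinant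
  -- inherits the representative's bound.
  obtain ⟨B, e, f, W, T, hW, hT, hTdet, hM⟩ := exists_lifted_spectrum (E := E) hr
    (x := fun c i => x (ρ (κ c)) i + a c)
    (fun c i j hij => hx _ (add_right_cancel hij))
    (fun c h => by
      rw [← mem_translatedCrossSection, ha, mem_translate, hxE]
      simp only [eq_sub_iff_add_eq]) hinj
  refine ⟨?_, B, e, f, W, T, hW, hM, hT, fun c => ?_⟩
  · rw [← hcard]
    exact Fintype.card_pos_iff.2 ⟨κ 0⟩
  · rw [hTdet, norm_det_charMatrix_add, mul_comm (k - 1), pow_mul]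
    exact hbound (κ c)

/-- The four tightness bounds for a multi-tile. -/
theorem tightness_bounds (H : AddSubgroup G) (E : Finset G) (ℓ k : ℕ) (hℓ : 1 ≤ ℓ)
    (hE : MultiTiles E (H : Set G) ℓ) (hk : numCrossSections E H = k)
    (hB : CrossSectionsHaveSimultaneousBasis E H) :
    rieszRatio E < ENNReal.ofReal (Real.exp 1 * (ℓ : ℝ) ^ (k * ℓ + 1)) ∧
      (1 < ℓ →
        normLower E < ENNReal.ofReal (Real.exp 1 * (ℓ : ℝ) ^ (k * ℓ)) ∧
        normUpper E
          < ENNReal.ofReal ((ℓ : ℝ) - ((ℓ : ℝ) - 1) / (2 ^ (k + 1) * (ℓ : ℝ) ^ k)) ∧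
        normDet E ≤ ENNReal.ofReal (Real.sqrt (ℓ : ℝ))) := by
  classical
  cases nonempty_fintype (G ⧸ H)
  obtain ⟨hk1, B, e, f, W, T, hW, hM, hT, hD⟩ := exists_spectrum_of_numCrossSections hE hk hB
  have hBE : B.card = E.card := by simpa using Fintype.card_congr (f.symm.trans e)
  have hkk : k - 1 + 1 = k := Nat.sub_add_cancel hk1
  have h1 := rieszRatioPair_lt hℓ hW hM hT hD
  have h2 := normLowerPair_lt hℓ hW hM hT hD
  have h3 := normUpperPair_lt hℓ hW hM hT hD
  rw [hkk] at h1 h2 h3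
  exact ⟨(iInf₂_le B hBE).trans_lt h1, fun hℓ1 => ⟨(iInf₂_le B hBE).trans_lt h2,
    (iInf₂_le B hBE).trans_lt (h3 hℓ1), normDet_le hℓ hE hB⟩⟩

end MultiTiling

end RieszTightness

theorem theorem1p6 :
    (∀ (G : Type*) [AddCommGroup G] [Finite G] (H : AddSubgroup G) (E : Finset G) (ℓ k : ℕ),
      1 ≤ ℓ →
      RieszTightness.MultiTiles E (H : Set G) ℓ →
      RieszTightness.numCrossSections E H = k →
      RieszTightness.CrossSectionsHaveSimultaneousBasis E H →
        RieszTightness.rieszRatio E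
            < ENNReal.ofReal (Real.exp 1 * (ℓ : ℝ) ^ (k * ℓ + 1)) ∧
        (1 < ℓ →
          RieszTightness.normLower E
              < ENNReal.ofReal (Real.exp 1 * (ℓ : ℝ) ^ (k * ℓ)) ∧
          RieszTightness.normUpper E
              < ENNReal.ofReal ((ℓ : ℝ) - ((ℓ : ℝ) - 1) / (2 ^ (k + 1) * (ℓ : ℝ) ^ k)) ∧
          RieszTightness.normDet E ≤ ENNReal.ofReal (Real.sqrt (ℓ : ℝ)))) ∧
    (∀ (G : ℕ → Type*) [∀ n, AddCommGroup (G n)] [∀ n, Finite (G n)]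
        (H : ∀ n, AddSubgroup (G n)) (E : ∀ n, Finset (G n)) (ℓ k : ℕ → ℕ),
      (∀ n, 1 ≤ ℓ n) →
      (∀ n, RieszTightness.MultiTiles (E n) (H n : Set (G n)) (ℓ n)) →
      (∀ n, RieszTightness.numCrossSections (E n) (H n) = k n) →
      (∀ n, RieszTightness.CrossSectionsHaveSimultaneousBasis (E n) (H n)) →
      BddAbove (Set.range ℓ) → BddAbove (Set.range k) →
        (∃ C : ℝ, ∀ n, RieszTightness.rieszRatio (E n) ≤ ENNReal.ofReal C) ∧
        ¬ Filter.Tendsto (fun n => RieszTightness.rieszRatio (E n)) Filter.atTop (𝓝 ⊤)) := by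
  refine ⟨fun G _ _ H E ℓ k => RieszTightness.tightness_bounds H E ℓ k, ?_⟩
  intro G _ _ H E ℓ k hℓ hE hk hB ⟨L, hL⟩ ⟨K, hK⟩
  have hbound : ∀ n, RieszTightness.rieszRatio (E n)
      ≤ ENNReal.ofReal (Real.exp 1 * (L : ℝ) ^ (K * L + 1)) := by
    intro n
    refine (RieszTightness.tightness_bounds (H n) (E n) (ℓ n) (k n) (hℓ n) (hE n) (hk n)
      (hB n)).1.le.trans (ENNReal.ofReal_le_ofReal ?_)
    have h1 : ℓ n ≤ L := hL ⟨n, rfl⟩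
    have h2 : k n ≤ K := hK ⟨n, rfl⟩
    -- `L ≥ 1` is what makes the power monotone in its exponent.
    have h3 : (1 : ℝ) ≤ L := by exact_mod_cast (hℓ n).trans h1
    have h4 : (ℓ n : ℝ) ≤ L := by exact_mod_cast h1
    gcongr ?_ * ?_
    calc (ℓ n : ℝ) ^ (k n * ℓ n + 1) ≤ (L : ℝ) ^ (k n * ℓ n + 1) := by gcongr
      _ ≤ (L : ℝ) ^ (K * L + 1) := pow_le_pow_right₀ h3 (by gcongr)
  refine ⟨⟨_, hbound⟩, fun htop => ?_⟩
  exact absurd (le_of_tendsto' htop hbound) (by simp)
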